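/- A set $\Omega\subset B(H)$ of operators on a separable complex Hilbert space $H$ is called quasidiagonal if there is an increasing sequence $(P_n)$ of compact self-adjoint projections on $H$ with $P_n\to 1_H$ strongly and $\|P_nT-TP_n\|\to 0$ for every $T\in\Omega$. A separable $C^*$-algebra $A$ is called strongly quasidiagonal if $\sigma(A)$ is a quasidiagonal set of operators for every representation ($*$-homomorphism) $\sigma\colon A\to B(H)$ on a separable Hilbert space $H$. Let $\Gamma=\mathbb Z/2\mathbb Z\wr\mathbb Z=\bigl(\bigoplus_{\mathbb Z}\mathbb Z/2\mathbb Z\bigr)\rtimes\mathbb Z$ be the lamplighter group (the restricted wreath product, with $\mathbb Z$ acting by shifts), regarded as a discrete group, and let $C^*(\Gamma)$ be its full group $C^*$-algebra, i.e. the completion of $\mathbb C[\Gamma]$ in the norm $\|a\|=\sup_\pi\|\pi(a)\|$, where $\pi$ ranges over all unitary representations of $\Gamma$ on Hilbert spaces. Then $C^*(\Gamma)$ is not strongly quasidiagonal. -/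

import Mathlib

open Filter Topology

universe u

/-! ### Restricted wreath products and the lamplighter group -/

/-- The restricted wreath product `D ≀ Q`: the subgroup of the unrestricted regular wreath product
`(Q → D) ⋊ Q` consisting of the pairs whose first component is finitely supported. -/
def restrictedWreathProduct (D Q : Type*) [Group D] [Group Q] : Subgroup (D ≀ᵣ Q) where
  carrier := {w | (Function.mulSupport w.left).Finite}
  one_mem' := by simp
  mul_mem' := by
    intro a b ha hb
    have hb' : (Function.mulSupport fun x => b.left (a.right⁻¹ * x)).Finite :=
      Set.Finite.preimage (f := fun x => a.right⁻¹ * x) (mul_right_injective _).injOn hb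
    exact (Set.Finite.union ha hb').subset (Function.mulSupport_mul _ _)
  inv_mem' := by
    intro a ha
    have h : (Function.mulSupport fun x => a.left (a.right * x)).Finite :=
      Set.Finite.preimage (f := fun x => a.right * x) (mul_right_injective _).injOn ha
    refine h.subset ?_
    intro x hx
    simpa using hx

instance restrictedWreathProduct.instCountable (D Q : Type*) [Group D] [Group Q] [Countable D]
    [Countable Q] : Countable (restrictedWreathProduct D Q) := by
  let F : restrictedWreathProduct D Q → (Q →₀ Additive D) × Q := fun w =>
    have hw : (Function.mulSupport w.1.left).Finite := w.2
    (⟨hw.toFinset, fun x => Additive.ofMul (w.1.left x), fun _ => hw.mem_toFinset⟩, w.1.right)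
  have : Countable (Additive D) := inferInstanceAs (Countable D)
  refine Function.Injective.countable (f := F) ?_
  intro v w h
  have h1 := congrArg Prod.fst h
  have h2 : v.1.right = w.1.right := congrArg Prod.snd h
  apply Subtype.ext
  apply RegularWreathProduct.ext
  · funext x
    exact DFunLike.congr_fun h1 x
  · exact h2

/-- The lamplighter group `(ℤ/2ℤ) ≀ ℤ`. -/
abbrev Lamplighter : Type :=
  restrictedWreathProduct (Multiplicative (ZMod 2)) (Multiplicative ℤ)

/-! ### The full group C⋆-algebra -/

noncomputable section

/-- A unitary representation of the (discrete) group `Γ` on a complex Hilbert space. -/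
structure UnitaryRep (Γ : Type u) [Group Γ] : Type (u + 1) where
  /-- The Hilbert space. -/
  H : Type u
  [normed : NormedAddCommGroup H]
  [inner : InnerProductSpace ℂ H]
  [complete : CompleteSpace H]
  /-- The homomorphism to the unitary group. -/
  hom : Γ →* unitary (H →L[ℂ] H)

attribute [instance] UnitaryRep.normed UnitaryRep.inner UnitaryRep.complete

/-- The complex group algebra `ℂ[Γ]`, which will carry the universal C⋆-seminorm. -/
def CGroupAlgebra (Γ : Type u) [Group Γ] : Type u := MonoidAlgebra ℂ Γ

namespace CGroupAlgebra

variable {Γ : Type u} [Group Γ]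

instance : Ring (CGroupAlgebra Γ) := inferInstanceAs (Ring (MonoidAlgebra ℂ Γ))
instance : Algebra ℂ (CGroupAlgebra Γ) := inferInstanceAs (Algebra ℂ (MonoidAlgebra ℂ Γ))

/-- The element `c • g` of `ℂ[Γ]`. -/
def single (g : Γ) (c : ℂ) : CGroupAlgebra Γ := MonoidAlgebra.single (R := ℂ) (M := Γ) g c

/-- The coefficients of an element of `ℂ[Γ]`. -/
def coeff (a : CGroupAlgebra Γ) : Γ →₀ ℂ := MonoidAlgebra.coeff (R := ℂ) (M := Γ) a

/-- The element of `ℂ[Γ]` with the given coefficients. -/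
def ofCoeff (f : Γ →₀ ℂ) : CGroupAlgebra Γ := MonoidAlgebra.ofCoeff (R := ℂ) (M := Γ) f

lemma ext_coeff {a b : CGroupAlgebra Γ} (h : ∀ g, coeff a g = coeff b g) : a = b :=
  MonoidAlgebra.coeff_injective (R := ℂ) (M := Γ) (Finsupp.ext h)

/-- The involution `(∑ c_g g)⋆ = ∑ conj(c_g) g⁻¹`, i.e. the coefficient of `a⋆` at `g` is the
conjugate of the coefficient of `a` at `g⁻¹`. -/
instance : Star (CGroupAlgebra Γ) where
  star a := ofCoeff
    (Finsupp.mapRange (starRingEnd ℂ) (map_zero _)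
      (Finsupp.equivMapDomain (Equiv.inv Γ) (coeff a)))

lemma coeff_star (a : CGroupAlgebra Γ) (g : Γ) :
    coeff (star a) g = starRingEnd ℂ (coeff a g⁻¹) := rfl

open Classical in
lemma coeff_single (g h : Γ) (c : ℂ) : coeff (single g c) h = if g = h then c else 0 := by
  change MonoidAlgebra.coeff (MonoidAlgebra.single (R := ℂ) (M := Γ) g c) h = _
  rw [MonoidAlgebra.coeff_single, Finsupp.single_apply]

lemma single_mul_single (g h : Γ) (c d : ℂ) :
    single g c * single h d = single (g * h) (c * d) :=
  MonoidAlgebra.single_mul_single (R := ℂ) (M := Γ) g h c d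

lemma star_single (g : Γ) (c : ℂ) : star (single g c) = single g⁻¹ (starRingEnd ℂ c) := by
  refine ext_coeff fun h => ?_
  rw [coeff_star, coeff_single, coeff_single]
  by_cases hg : g = h⁻¹
  · rw [if_pos hg, if_pos (inv_eq_iff_eq_inv.2 hg)]
  · rw [if_neg hg, if_neg (fun H => hg (inv_eq_iff_eq_inv.1 H)), map_zero]

lemma star_add' (a b : CGroupAlgebra Γ) : star (a + b) = star a + star b := by
  refine ext_coeff fun h => ?_
  exact map_add (starRingEnd ℂ) _ _

@[elab_as_elim]
lemma induction {p : CGroupAlgebra Γ → Prop} (a : CGroupAlgebra Γ) (zero : p 0)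
    (add : ∀ a b, p a → p b → p (a + b)) (single : ∀ g c, p (single g c)) : p a := by
  have key : ∀ f : Γ →₀ ℂ, p (ofCoeff f) := by
    intro f
    induction f using Finsupp.induction_linear with
    | zero => exact zero
    | add f g hf hg => exact add _ _ hf hg
    | single g c => exact single g c
  exact key (coeff a)

lemma star_zero' : star (0 : CGroupAlgebra Γ) = 0 := by
  refine ext_coeff fun h => ?_
  exact map_zero (starRingEnd ℂ)

instance : StarRing (CGroupAlgebra Γ) where
  star_involutive a := by
    refine ext_coeff fun h => ?_
    rw [coeff_star, coeff_star, inv_inv, Complex.conj_conj]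
  star_add := star_add'
  star_mul a b := by
    induction a using induction with
    | zero => simp [star_zero']
    | add a a' ha ha' => rw [add_mul, star_add', star_add', ha, ha', mul_add]
    | single g c =>
      induction b using induction with
      | zero => simp [star_zero']
      | add b b' hb hb' => rw [mul_add, star_add', star_add', hb, hb', add_mul]
      | single h d =>
        simp only [single_mul_single, star_single, map_mul, mul_inv_rev, mul_comm]

lemma algebraMap_eq (c : ℂ) : algebraMap ℂ (CGroupAlgebra Γ) c = single 1 c := rfl

instance : StarModule ℂ (CGroupAlgebra Γ) where
  star_smul c a := by
    rw [Algebra.smul_def, Algebra.smul_def, star_mul, algebraMap_eq, star_single, inv_one,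
      ← algebraMap_eq]
    exact (Algebra.commutes _ _).symm

end CGroupAlgebra

namespace UnitaryRep

variable {Γ : Type u} [Group Γ]

open CGroupAlgebra

/-- The linear extension of a unitary representation to `ℂ[Γ]`. -/
def toAlgHom (π : UnitaryRep Γ) : CGroupAlgebra Γ →ₐ[ℂ] (π.H →L[ℂ] π.H) :=
  MonoidAlgebra.lift ℂ (π.H →L[ℂ] π.H) Γ ((unitary (π.H →L[ℂ] π.H)).subtype.comp π.hom)

lemma toAlgHom_single (π : UnitaryRep Γ) (g : Γ) (c : ℂ) :
    π.toAlgHom (single g c) = c • (π.hom g : π.H →L[ℂ] π.H) :=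
  MonoidAlgebra.lift_single _ _ _

lemma toAlgHom_star (π : UnitaryRep Γ) (a : CGroupAlgebra Γ) :
    π.toAlgHom (star a) = star (π.toAlgHom a) := by
  induction a using CGroupAlgebra.induction with
  | zero => simp
  | add a b ha hb => simp only [star_add, map_add, ha, hb]
  | single g c =>
    rw [star_single, toAlgHom_single, toAlgHom_single, star_smul, map_inv]
    rfl

lemma norm_toAlgHom_single_le (π : UnitaryRep Γ) (g : Γ) (c : ℂ) :
    ‖π.toAlgHom (single g c)‖ ≤ ‖c‖ := by
  rw [toAlgHom_single, norm_smul]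
  refine mul_le_of_le_one_right (norm_nonneg _) ?_
  have h : ‖(π.hom g : π.H →L[ℂ] π.H)‖ * ‖(π.hom g : π.H →L[ℂ] π.H)‖ ≤ 1 := by
    rw [← CStarRing.norm_star_mul_self, Unitary.coe_star_mul_self]
    exact ContinuousLinearMap.norm_id_le
  nlinarith [norm_nonneg (π.hom g : π.H →L[ℂ] π.H)]

/-- The values `‖π(a)‖` are bounded uniformly in `π`. -/
lemma bddAbove_norm (a : CGroupAlgebra Γ) :
    BddAbove (Set.range fun π : UnitaryRep Γ => ‖π.toAlgHom a‖) := by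
  suffices h : ∃ C : ℝ, ∀ π : UnitaryRep Γ, ‖π.toAlgHom a‖ ≤ C by
    obtain ⟨C, hC⟩ := h
    exact ⟨C, by rintro _ ⟨π, rfl⟩; exact hC π⟩
  induction a using CGroupAlgebra.induction with
  | zero => exact ⟨0, fun π => by simp⟩
  | add a b ha hb =>
    obtain ⟨C, hC⟩ := ha
    obtain ⟨D, hD⟩ := hb
    refine ⟨C + D, fun π => ?_⟩
    rw [map_add]
    exact (norm_add_le _ _).trans (add_le_add (hC π) (hD π))
  | single g c => exact ⟨‖c‖, fun π => π.norm_toAlgHom_single_le g c⟩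

end UnitaryRep

namespace CGroupAlgebra

variable {Γ : Type u} [Group Γ]

/-- The universal norm `‖a‖ = sup_π ‖π(a)‖` over all unitary representations `π` of `Γ`. -/
instance : Norm (CGroupAlgebra Γ) where
  norm a := ⨆ π : UnitaryRep Γ, ‖π.toAlgHom a‖

lemma norm_def (a : CGroupAlgebra Γ) : ‖a‖ = ⨆ π : UnitaryRep Γ, ‖π.toAlgHom a‖ := rfl

lemma norm_toAlgHom_le (π : UnitaryRep Γ) (a : CGroupAlgebra Γ) : ‖π.toAlgHom a‖ ≤ ‖a‖ :=
  le_ciSup (UnitaryRep.bddAbove_norm a) π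

lemma norm_le_of {a : CGroupAlgebra Γ} {C : ℝ} (hC : 0 ≤ C)
    (h : ∀ π : UnitaryRep Γ, ‖π.toAlgHom a‖ ≤ C) : ‖a‖ ≤ C :=
  Real.iSup_le h hC

lemma univ_norm_nonneg (a : CGroupAlgebra Γ) : 0 ≤ ‖a‖ :=
  Real.iSup_nonneg fun _ => norm_nonneg _

/-- The universal norm as a ring seminorm. -/
def univSeminorm (Γ : Type u) [Group Γ] : RingSeminorm (CGroupAlgebra Γ) where
  toFun a := ‖a‖
  map_zero' := le_antisymm (norm_le_of le_rfl fun π => by simp) (univ_norm_nonneg _)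
  add_le' a b := by
    refine norm_le_of (add_nonneg (univ_norm_nonneg a) (univ_norm_nonneg b)) fun π => ?_
    rw [map_add]
    exact (norm_add_le _ _).trans (add_le_add (norm_toAlgHom_le π a) (norm_toAlgHom_le π b))
  neg' a := by simp only [norm_def, map_neg, norm_neg]
  mul_le' a b := by
    refine norm_le_of (mul_nonneg (univ_norm_nonneg a) (univ_norm_nonneg b)) fun π => ?_
    rw [map_mul]
    exact (norm_mul_le _ _).trans (mul_le_mul (norm_toAlgHom_le π a) (norm_toAlgHom_le π b)
      (norm_nonneg _) (univ_norm_nonneg a))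

instance : SeminormedRing (CGroupAlgebra Γ) where
  __ := (inferInstance : Ring (CGroupAlgebra Γ))
  __ := (univSeminorm Γ).toAddGroupSeminorm.toSeminormedAddCommGroup
  norm := fun a => ‖a‖
  norm_mul_le := (univSeminorm Γ).mul_le'

instance : NormedAlgebra ℂ (CGroupAlgebra Γ) where
  norm_smul_le c a := by
    refine norm_le_of (mul_nonneg (norm_nonneg c) (univ_norm_nonneg a)) fun π => ?_
    rw [map_smul, norm_smul]
    exact mul_le_mul_of_nonneg_left (norm_toAlgHom_le π a) (norm_nonneg c)

instance : NormedStarGroup (CGroupAlgebra Γ) where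
  norm_star_le a := by
    refine norm_le_of (norm_nonneg a) fun π => ?_
    rw [π.toAlgHom_star, norm_star]
    exact norm_toAlgHom_le π a

lemma norm_mul_self_le (a : CGroupAlgebra Γ) : ‖a‖ * ‖a‖ ≤ ‖star a * a‖ := by
  have h : ‖a‖ ≤ √‖star a * a‖ := by
    refine norm_le_of (Real.sqrt_nonneg _) fun π => ?_
    refine Real.le_sqrt_of_sq_le ?_
    rw [sq, ← CStarRing.norm_star_mul_self, ← π.toAlgHom_star, ← map_mul]
    exact norm_toAlgHom_le π _
  calc ‖a‖ * ‖a‖ ≤ √‖star a * a‖ * √‖star a * a‖ :=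
        mul_le_mul h h (norm_nonneg _) (Real.sqrt_nonneg _)
    _ = ‖star a * a‖ := Real.mul_self_sqrt (norm_nonneg _)

lemma norm_single_le (g : Γ) (c : ℂ) : ‖single g c‖ ≤ ‖c‖ :=
  norm_le_of (norm_nonneg c) fun π => π.norm_toAlgHom_single_le g c

instance [Countable Γ] : TopologicalSpace.SeparableSpace (CGroupAlgebra Γ) := by
  have hs : TopologicalSpace.IsSeparable
      (Submodule.span ℂ (Set.range fun g : Γ => single g 1) : Set (CGroupAlgebra Γ)) :=
    (Set.countable_range _).isSeparable.span
  have ht : (Submodule.span ℂ (Set.range fun g : Γ => single g 1) : Submodule ℂ (CGroupAlgebra Γ))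
      = ⊤ := by
    refine Submodule.eq_top_iff'.2 fun a => ?_
    induction a using induction with
    | zero => exact Submodule.zero_mem _
    | add a b ha hb => exact Submodule.add_mem _ ha hb
    | single g c =>
      have : single g c = c • single g 1 := by
        rw [Algebra.smul_def, algebraMap_eq, single_mul_single, one_mul, mul_one]
      rw [this]
      exact Submodule.smul_mem _ _ (Submodule.subset_span ⟨g, rfl⟩)
  rw [ht, Submodule.top_coe] at hs
  exact TopologicalSpace.isSeparable_univ_iff.1 hs

end CGroupAlgebra

/-- The full group C⋆-algebra `C⋆(Γ)`: the (Hausdorff) completion of `ℂ[Γ]` in the universal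
norm. -/
def FullGroupCStarAlgebra (Γ : Type u) [Group Γ] : Type u :=
  UniformSpace.Completion (CGroupAlgebra Γ)

namespace FullGroupCStarAlgebra

variable (Γ : Type u) [Group Γ]

instance : NormedRing (FullGroupCStarAlgebra Γ) :=
  inferInstanceAs (NormedRing (UniformSpace.Completion (CGroupAlgebra Γ)))

instance : CompleteSpace (FullGroupCStarAlgebra Γ) :=
  inferInstanceAs (CompleteSpace (UniformSpace.Completion (CGroupAlgebra Γ)))

instance : Algebra ℂ (FullGroupCStarAlgebra Γ) :=
  inferInstanceAs (Algebra ℂ (UniformSpace.Completion (CGroupAlgebra Γ)))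

instance : NormedAlgebra ℂ (FullGroupCStarAlgebra Γ) where
  norm_smul_le :=
    (inferInstance : NormedSpace ℂ (UniformSpace.Completion (CGroupAlgebra Γ))).norm_smul_le

/-- The continuous extension of the involution of `ℂ[Γ]`. -/
instance : Star (FullGroupCStarAlgebra Γ) where
  star := UniformSpace.Completion.map (star : CGroupAlgebra Γ → CGroupAlgebra Γ)

variable {Γ}

/-- The canonical map `ℂ[Γ] → C⋆(Γ)`. -/
def of (a : CGroupAlgebra Γ) : FullGroupCStarAlgebra Γ :=
  ((a : CGroupAlgebra Γ) : UniformSpace.Completion (CGroupAlgebra Γ))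

lemma of_add (a b : CGroupAlgebra Γ) : of (a + b) = of a + of b :=
  UniformSpace.Completion.coe_add a b

lemma of_mul (a b : CGroupAlgebra Γ) : of (a * b) = of a * of b :=
  UniformSpace.Completion.coe_mul a b

lemma of_smul (c : ℂ) (a : CGroupAlgebra Γ) : of (c • a) = c • of a :=
  UniformSpace.Completion.coe_smul c a

lemma norm_of (a : CGroupAlgebra Γ) : ‖of a‖ = ‖a‖ :=
  UniformSpace.Completion.norm_coe a

lemma denseRange_of : DenseRange (of : CGroupAlgebra Γ → FullGroupCStarAlgebra Γ) :=
  UniformSpace.Completion.denseRange_coe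

lemma of_star (a : CGroupAlgebra Γ) : of (star a) = star (of a) :=
  (UniformSpace.Completion.map_coe (star_isometry (E := CGroupAlgebra Γ)).uniformContinuous a).symm

lemma continuous_star' : Continuous (star : FullGroupCStarAlgebra Γ → FullGroupCStarAlgebra Γ) :=
  UniformSpace.Completion.continuous_map

instance : CStarAlgebra (FullGroupCStarAlgebra Γ) where
  star_involutive x := by
    refine denseRange_of.induction_on x
      (isClosed_eq (continuous_star'.comp continuous_star') continuous_id) fun a => ?_
    rw [← of_star, ← of_star, star_star]
  star_add x y := by
    refine denseRange_of.induction_on₂ (p := fun x y => star (x + y) = star x + star y)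
      (isClosed_eq (continuous_star'.comp continuous_add)
        ((continuous_star'.comp continuous_fst).add (continuous_star'.comp continuous_snd)))
      (fun a b => ?_) x y
    rw [← of_add, ← of_star, ← of_star, ← of_star, ← of_add, star_add]
  star_mul x y := by
    refine denseRange_of.induction_on₂ (p := fun x y => star (x * y) = star y * star x)
      (isClosed_eq (continuous_star'.comp continuous_mul)
        ((continuous_star'.comp continuous_snd).mul (continuous_star'.comp continuous_fst)))
      (fun a b => ?_) x y
    rw [← of_mul, ← of_star, ← of_star, ← of_star, ← of_mul, star_mul]
  star_smul c x := by
    refine denseRange_of.induction_on x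
      (isClosed_eq (continuous_star'.comp (continuous_const_smul c))
        (continuous_star'.const_smul (star c))) fun a => ?_
    rw [← of_smul, ← of_star, ← of_star, ← of_smul, star_smul]
  norm_mul_self_le x := by
    refine denseRange_of.induction_on x
      (isClosed_le (continuous_norm.mul continuous_norm)
        (continuous_norm.comp (continuous_star'.mul continuous_id))) fun a => ?_
    rw [← of_star, ← of_mul, norm_of, norm_of]
    exact CGroupAlgebra.norm_mul_self_le a

instance [Countable Γ] : TopologicalSpace.SeparableSpace (FullGroupCStarAlgebra Γ) :=
  inferInstanceAs (TopologicalSpace.SeparableSpace (UniformSpace.Completion (CGroupAlgebra Γ)))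

end FullGroupCStarAlgebra

end

/-! ### Quasidiagonality -/

/-- A set `Ω` of operators on a separable Hilbert space `H` is quasidiagonal if there is an
increasing sequence of compact self-adjoint projections `P n`, converging strongly to the identity,
with `‖[P n, T]‖ → 0` for every `T ∈ Ω`. -/
def IsQuasidiagonalSet {H : Type*} [NormedAddCommGroup H] [InnerProductSpace ℂ H] [CompleteSpace H]
    [TopologicalSpace.SeparableSpace H] (Ω : Set (H →L[ℂ] H)) : Prop :=
  ∃ P : ℕ → (H →L[ℂ] H),
    (∀ n, IsStarProjection (P n)) ∧
    (∀ n, IsCompactOperator (P n)) ∧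
    (∀ m n, m ≤ n → P m * P n = P m) ∧
    (∀ x : H, Tendsto (fun n => P n x) atTop (𝓝 x)) ∧
    ∀ T ∈ Ω, Tendsto (fun n => ‖P n * T - T * P n‖) atTop (𝓝 0)

/-- A separable C⋆-algebra `A` is strongly quasidiagonal if `σ(A)` is a quasidiagonal set of
operators for every representation `σ` of `A` on a separable Hilbert space. -/
def IsStronglyQuasidiagonal (A : Type*) [NonUnitalCStarAlgebra A]
    [TopologicalSpace.SeparableSpace A] : Prop :=
  ∀ (H : Type) [NormedAddCommGroup H] [InnerProductSpace ℂ H] [CompleteSpace H]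
    [TopologicalSpace.SeparableSpace H] (σ : A →⋆ₙₐ[ℂ] (H →L[ℂ] H)),
    IsQuasidiagonalSet (Set.range σ)

/-!
The full group C⋆-algebra of the lamplighter group has a representation on `ℓ²(ℤ)` whose range
contains a proper isometry, and a quasidiagonal set of operators contains no proper isometry.

For the representation (`lamplighterRep`), let `ℤ` act by the bilateral shift `u`, and let a lamp
configuration act as the diagonal operator whose `n`-th entry is `(-1) ^ m`, with `m` the number of
lit lamps at positions `k ≤ n`. The lamp `a` at `0` is then `-1` on `ℓ²(ℤ≥0)` and `1` on the
orthogonal complement, so that `p = (1 - a) / 2` is the projection onto `ℓ²(ℤ≥0)` and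
`u p + (1 - p)` is the unilateral shift on `ℓ²(ℤ≥0)` plus the identity on the complement. It
preserves norms (`norm_halfShiftOp_apply`), and the basis vector at `0` is orthogonal to its range.

For the obstruction (`IsQuasidiagonalSet.eq_zero_of_forall_inner_eq_zero`), let `P` be a compact
projection that almost commutes with the isometry `S`. The compression of `S` to the range of `P`
is almost isometric, and this range is finite-dimensional, so the compression is onto. A vector `e`
orthogonal to the range of `S` therefore has `P e` of the form `P S v` with `v` in the range of `P`,
and `P S v` is close to `S v`, which is orthogonal to `e`. Hence `P e` is small
(`IsCompactOperator.one_sub_mul_norm_apply_le`), and it tends to `e` along a sequence of such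
projections that increases to the identity.
-/

/-! ### Quasidiagonal sets contain no proper isometries -/

/-- If a compact projection `P` almost commutes with an isometry `S`, then it almost annihilates
the vectors orthogonal to the range of `S`. -/
theorem IsCompactOperator.one_sub_mul_norm_apply_le {H : Type*} [NormedAddCommGroup H]
    [InnerProductSpace ℂ H] [CompleteSpace H] {P S : H →L[ℂ] H} (hP : IsStarProjection P)
    (hPc : IsCompactOperator P) (hS : ∀ x, ‖S x‖ = ‖x‖) {e : H} (he : ∀ x, inner ℂ (S x) e = 0)
    (hδ : ‖P * S - S * P‖ < 1) :
    (1 - ‖P * S - S * P‖) * ‖P e‖ ≤ ‖P * S - S * P‖ * ‖e‖ := by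
  set δ := ‖P * S - S * P‖ with hδdef
  have hPP (x : H) : P (P x) = P x := congrArg (fun T : H →L[ℂ] H => T x) hP.isIdempotentElem
  let V := Module.End.eigenspace (P : H →ₗ[ℂ] H) 1
  have hV {x : H} : x ∈ V ↔ P x = x := by simp [V]
  have : FiniteDimensional ℂ V :=
    ContinuousLinearMap.finite_dimensional_eigenspace hPc 1 one_ne_zero
  have hcomm (x : H) (hx : x ∈ V) : ‖P (S x) - S x‖ ≤ δ * ‖x‖ := by
    have := (P * S - S * P).le_opNorm x
    simpa [hV.1 hx] using this
  have hlow (x : H) (hx : x ∈ V) : (1 - δ) * ‖x‖ ≤ ‖P (S x)‖ := by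
    have h1 := hcomm x hx
    have h2 := norm_sub_norm_le (S x) (P (S x))
    rw [norm_sub_rev, hS] at h2
    linarith
  let T : V →ₗ[ℂ] V := ((P * S : H →L[ℂ] H) : H →ₗ[ℂ] H).restrict
    (p := V) (q := V) fun x _ => hV.2 (hPP _)
  have hT (x : V) : (T x : H) = P (S x) := rfl
  -- The compression is bounded below on a finite-dimensional space, hence onto.
  have hsurj : Function.Surjective T := by
    refine LinearMap.injective_iff_surjective.1 ((injective_iff_map_eq_zero T).2 fun x hx => ?_)
    have h := hlow x x.2
    rw [← hT, hx] at h
    have h0 : ‖(x : H)‖ ≤ 0 := by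
      by_contra! h'
      have := mul_pos (sub_pos.2 hδ) h'
      simp at h
      linarith
    exact Subtype.ext (norm_le_zero_iff.1 h0)
  obtain ⟨⟨v, hv⟩, hvT⟩ := hsurj ⟨P e, hV.2 (hPP e)⟩
  have hve : P (S v) = P e := congrArg Subtype.val hvT
  have h1 := hcomm v hv
  have h2 := hlow v hv
  rw [hve] at h1 h2
  have h3 : ‖P e‖ * ‖P e‖ ≤ δ * ‖v‖ * ‖e‖ := by
    have h4 : inner ℂ (P e) (P e) = inner ℂ (P e - S v) e := by
      rw [inner_sub_left, he, sub_zero, ← ContinuousLinearMap.adjoint_inner_left,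
        ← ContinuousLinearMap.star_eq_adjoint, hP.isSelfAdjoint.star_eq, hPP]
    calc ‖P e‖ * ‖P e‖ = ‖inner ℂ (P e) (P e)‖ := by
          rw [inner_self_eq_norm_sq_to_K]; simp [sq]
      _ ≤ ‖P e - S v‖ * ‖e‖ := h4 ▸ norm_inner_le_norm _ _
      _ ≤ _ := mul_le_mul_of_nonneg_right h1 (norm_nonneg _)
  rcases (norm_nonneg (P e)).eq_or_lt with h | h
  · rw [← h, mul_zero]; positivity
  · refine le_of_mul_le_mul_right ?_ h
    have h5 : 0 ≤ δ * ‖e‖ := by positivity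
    nlinarith [mul_le_mul_of_nonneg_left h2 h5, mul_le_mul_of_nonneg_left h3 (sub_pos.2 hδ).le]

/-- An isometry in a quasidiagonal set has trivial orthogonal complement of its range. -/
theorem IsQuasidiagonalSet.eq_zero_of_forall_inner_eq_zero {H : Type*} [NormedAddCommGroup H]
    [InnerProductSpace ℂ H] [CompleteSpace H] [TopologicalSpace.SeparableSpace H]
    {Ω : Set (H →L[ℂ] H)} (hΩ : IsQuasidiagonalSet Ω) {S : H →L[ℂ] H} (hSΩ : S ∈ Ω)
    (hS : ∀ x, ‖S x‖ = ‖x‖) {e : H} (he : ∀ x, inner ℂ (S x) e = 0) : e = 0 := by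
  obtain ⟨P, hP, hPc, -, hP1, hcomm⟩ := hΩ
  have hlim := hcomm S hSΩ
  have h : (1 - 0) * ‖e‖ ≤ 0 * ‖e‖ :=
    le_of_tendsto_of_tendsto ((hlim.const_sub 1).mul (hP1 e).norm) (hlim.mul_const ‖e‖)
      ((hlim.eventually_lt_const one_pos).mono fun n hn =>
        (hPc n).one_sub_mul_norm_apply_le (hP n) hS he hn)
  simpa using h

noncomputable section

/-! ### Representations of `C⋆(Γ)` from unitary representations of `Γ` -/

/-- A homomorphism from a group to the norm-preserving operators takes unitary values. -/
theorem mem_unitary_of_norm_map {G H : Type*} [Group G] [NormedAddCommGroup H]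
    [InnerProductSpace ℂ H] [CompleteSpace H] (ρ : G →* (H →L[ℂ] H))
    (hρ : ∀ g x, ‖ρ g x‖ = ‖x‖) (g : G) : ρ g ∈ unitary (H →L[ℂ] H) := by
  have h1 : star (ρ g) * ρ g = 1 := (ρ g).norm_map_iff_adjoint_comp_self.1 (hρ g)
  have h2 : ρ g * ρ g⁻¹ = 1 := by rw [← map_mul, mul_inv_cancel, map_one]
  refine Unitary.mem_iff.2 ⟨h1, ?_⟩
  rwa [left_inv_eq_right_inv h1 h2]

namespace UnitaryRep

variable {Γ : Type u} [Group Γ] (π : UnitaryRep Γ)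

theorem continuous_toAlgHom : Continuous π.toAlgHom :=
  AddMonoidHomClass.continuous_of_bound π.toAlgHom 1 fun a => by
    simpa using CGroupAlgebra.norm_toAlgHom_le π a

/-- The continuous extension of a unitary representation from `ℂ[Γ]` to `C⋆(Γ)`, as a ring
homomorphism. -/
def extendRingHom : FullGroupCStarAlgebra Γ →+* (π.H →L[ℂ] π.H) :=
  UniformSpace.Completion.extensionHom π.toAlgHom.toRingHom π.continuous_toAlgHom

theorem continuous_extendRingHom : Continuous π.extendRingHom :=
  UniformSpace.Completion.continuous_extension

theorem extendRingHom_of (a : CGroupAlgebra Γ) :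
    π.extendRingHom (FullGroupCStarAlgebra.of a) = π.toAlgHom a :=
  UniformSpace.Completion.extensionHom_coe π.toAlgHom.toRingHom π.continuous_toAlgHom a

theorem extendRingHom_smul (c : ℂ) (x : FullGroupCStarAlgebra Γ) :
    π.extendRingHom (c • x) = c • π.extendRingHom x := by
  refine FullGroupCStarAlgebra.denseRange_of.induction_on
    (p := fun x => π.extendRingHom (c • x) = c • π.extendRingHom x) x
    (isClosed_eq (π.continuous_extendRingHom.comp (continuous_const_smul c))
      (π.continuous_extendRingHom.const_smul c)) fun a => ?_
  rw [← FullGroupCStarAlgebra.of_smul, extendRingHom_of, extendRingHom_of, map_smul]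

theorem extendRingHom_star (x : FullGroupCStarAlgebra Γ) :
    π.extendRingHom (star x) = star (π.extendRingHom x) := by
  refine FullGroupCStarAlgebra.denseRange_of.induction_on
    (p := fun x => π.extendRingHom (star x) = star (π.extendRingHom x)) x
    (isClosed_eq (π.continuous_extendRingHom.comp FullGroupCStarAlgebra.continuous_star')
      π.continuous_extendRingHom.star) fun a => ?_
  rw [← FullGroupCStarAlgebra.of_star, extendRingHom_of, extendRingHom_of, π.toAlgHom_star]

/-- The *-homomorphism `C⋆(Γ) → B(H)` induced by a unitary representation of `Γ` on `H`. -/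
def extend : FullGroupCStarAlgebra Γ →⋆ₙₐ[ℂ] (π.H →L[ℂ] π.H) where
  toFun := π.extendRingHom
  map_smul' := π.extendRingHom_smul
  map_zero' := map_zero π.extendRingHom
  map_add' := map_add π.extendRingHom
  map_mul' := map_mul π.extendRingHom
  map_star' := π.extendRingHom_star

/-- If `C⋆(Γ)` is strongly quasidiagonal, then an element of `ℂ[Γ]` that acts as an isometry in a
unitary representation leaves no nonzero vector orthogonal to its range. -/
theorem eq_zero_of_isStronglyQuasidiagonal {Γ : Type} [Group Γ] [Countable Γ]
    (h : IsStronglyQuasidiagonal (FullGroupCStarAlgebra Γ)) (π : UnitaryRep Γ)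
    [TopologicalSpace.SeparableSpace π.H] (a : CGroupAlgebra Γ)
    (hS : ∀ x, ‖π.toAlgHom a x‖ = ‖x‖) {e : π.H} (he : ∀ x, Inner.inner ℂ (π.toAlgHom a x) e = 0) :
    e = 0 :=
  (h π.H π.extend).eq_zero_of_forall_inner_eq_zero ⟨_, π.extendRingHom_of a⟩ hS he

end UnitaryRep

/-! ### Signed shifts on `ℓ²(ℤ)` -/

/-- The Hilbert space `ℓ²(ℤ)`. -/
abbrev EllTwo : Type := lp (fun _ : ℤ => ℂ) 2

instance EllTwo.instSeparableSpace : TopologicalSpace.SeparableSpace EllTwo := by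
  have hs : TopologicalSpace.IsSeparable (closure
      (Submodule.span ℂ (Set.range fun n : ℤ => (lp.single 2 n 1 : EllTwo)) : Set EllTwo)) :=
    (Set.countable_range _).isSeparable.span.closure
  refine TopologicalSpace.isSeparable_univ_iff.1 (hs.mono fun f _ => ?_)
  refine mem_closure_of_tendsto (lp.hasSum_single (by simp) f) (Eventually.of_forall fun s => ?_)
  refine Submodule.sum_mem _ fun n _ => ?_
  have : lp.single 2 n (f n) = f n • (lp.single 2 n 1 : EllTwo) := by
    rw [← lp.single_smul]; simp
  rw [this]
  exact Submodule.smul_mem _ _ (Submodule.subset_span ⟨n, rfl⟩)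

theorem norm_intCast_units (u : ℤˣ) : ‖((u : ℤ) : ℂ)‖ = 1 := by
  obtain rfl | rfl := Int.units_eq_one_or u <;> simp

/-- The weighted shift `(ξ n)ₙ ↦ (c n * ξ (n - q))ₙ` on `ℓ²(ℤ)`, with weights `c n = ± 1`. -/
def signedShift (c : ℤ → ℤˣ) (q : ℤ) : EllTwo →ₗᵢ[ℂ] EllTwo where
  toFun ξ := ⟨fun n => ((c n : ℤ) : ℂ) * ξ (n - q), by
    refine (memℓp_gen_iff (by norm_num)).2 ?_
    simp_rw [norm_mul, norm_intCast_units, one_mul]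
    exact (Equiv.subRight q).summable_iff.2 ((memℓp_gen_iff (by norm_num)).1 (lp.memℓp ξ))⟩
  map_add' ξ η := by ext n; exact mul_add _ _ _
  map_smul' z ξ := by ext n; exact mul_left_comm _ _ _
  norm_map' ξ := by
    rw [lp.norm_eq_tsum_rpow (by norm_num), lp.norm_eq_tsum_rpow (by norm_num)]
    simp only [LinearMap.coe_mk, AddHom.coe_mk, norm_mul, norm_intCast_units, one_mul]
    exact congrArg (· ^ _) ((Equiv.subRight q).tsum_eq fun n => ‖ξ n‖ ^ (2 : ENNReal).toReal)

theorem signedShift_apply (c : ℤ → ℤˣ) (q : ℤ) (ξ : EllTwo) (n : ℤ) :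
    signedShift c q ξ n = ((c n : ℤ) : ℂ) * ξ (n - q) := rfl

/-! ### The lamplighter group acting on `ℓ²(ℤ)` -/

/-- `(-1) ^ m`, where `m` is the number of lamps at positions `k ≤ n` that are lit in the
configuration `f`, assumed finitely supported: on other configurations the `finprod` may take its
junk value `1`. -/
def lampSign (f : Multiplicative ℤ → Multiplicative (ZMod 2)) (n : ℤ) : ℤˣ :=
  ∏ᶠ k : ℤ, if k ≤ n then (-1 : ℤˣ) ^ (f (.ofAdd k)).toAdd else 1

theorem lampSign_one (n : ℤ) : lampSign 1 n = 1 := by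
  simp [lampSign]

theorem lampSign_mul {f g : Multiplicative ℤ → Multiplicative (ZMod 2)}
    (hf : (Function.mulSupport f).Finite) (hg : (Function.mulSupport g).Finite) (n : ℤ) :
    lampSign (f * g) n = lampSign f n * lampSign g n := by
  have key {f : Multiplicative ℤ → Multiplicative (ZMod 2)} (hf : (Function.mulSupport f).Finite) :
      Function.HasFiniteMulSupport fun k : ℤ =>
        if k ≤ n then (-1 : ℤˣ) ^ (f (.ofAdd k)).toAdd else 1 := by
    refine (hf.preimage (f := Multiplicative.ofAdd)
      Multiplicative.ofAdd.injective.injOn).subset fun k hk h1 => hk ?_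
    simp [show f (.ofAdd k) = 1 from h1]
  rw [lampSign, lampSign, lampSign, ← finprod_mul_distrib (key hf) (key hg)]
  refine finprod_congr fun k => ?_
  split_ifs <;> simp [uzpow_add]

theorem lampSign_translate (f : Multiplicative ℤ → Multiplicative (ZMod 2))
    (q : Multiplicative ℤ) (n : ℤ) :
    lampSign (fun x => f (q⁻¹ * x)) n = lampSign f (n - q.toAdd) := by
  rw [lampSign, lampSign,
    ← finprod_comp_equiv (f := fun k : ℤ => ite (k ≤ n - q.toAdd) _ _) (Equiv.subRight q.toAdd)]
  refine finprod_congr fun k => ?_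
  have : q⁻¹ * Multiplicative.ofAdd k = Multiplicative.ofAdd (k - q.toAdd) := by
    rw [mul_comm]; rfl
  simp only [this, Equiv.subRight_apply, sub_le_sub_iff_right]

theorem lampSign_mulSingle (n : ℤ) :
    lampSign (Pi.mulSingle 1 (.ofAdd 1)) n = if 0 ≤ n then -1 else 1 := by
  rw [lampSign, finprod_eq_single _ 0]
  · simp
  · intro k hk
    have : Multiplicative.ofAdd k ≠ 1 := by simpa using hk
    simp [Pi.mulSingle_eq_of_ne this]

/-- The representation of the lamplighter group on `ℓ²(ℤ)` in which the generator of `ℤ` acts as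
the bilateral shift and a lamp configuration acts as multiplication by `lampSign`. -/
def lamplighterAction : Lamplighter →* (EllTwo →L[ℂ] EllTwo) where
  toFun w := (signedShift (lampSign w.1.left) w.1.right.toAdd).toContinuousLinearMap
  map_one' := by
    ext ξ n
    simp [signedShift_apply, lampSign_one]
  map_mul' v w := by
    have hv : (Function.mulSupport v.1.left).Finite := v.2
    have hw : (Function.mulSupport fun x => w.1.left (v.1.right⁻¹ * x)).Finite :=
      Set.Finite.preimage (f := fun x => v.1.right⁻¹ * x) (mul_right_injective _).injOn w.2
    ext ξ n
    simp [signedShift_apply, lampSign_mul hv hw, lampSign_translate, mul_assoc, sub_sub]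

/-- `lamplighterAction` as a unitary representation. -/
def lamplighterRep : UnitaryRep Lamplighter where
  H := EllTwo
  hom := lamplighterAction.codRestrict (unitary (EllTwo →L[ℂ] EllTwo))
    (mem_unitary_of_norm_map lamplighterAction fun _ ξ => LinearIsometry.norm_map _ ξ)

/-- The generator of `ℤ`. -/
def Lamplighter.shift : Lamplighter := ⟨⟨1, .ofAdd 1⟩, by
  simp [restrictedWreathProduct]⟩

/-- The configuration in which only the lamp at `0` is lit. -/
def Lamplighter.lamp : Lamplighter := ⟨⟨Pi.mulSingle 1 (.ofAdd 1), 1⟩,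
  (Set.finite_singleton 1).subset Pi.mulSupport_mulSingle_subset⟩

/-! ### A proper isometry in the image of the group algebra -/

open CGroupAlgebra Lamplighter in
/-- The element `u p + (1 - p)` of `ℂ[Γ]`, where `u` is the shift, `a` the lamp at `0` and
`p = (1 - a) / 2`, which `lamplighterRep` maps to the projection onto `ℓ²(ℤ≥0)`. -/
def halfShift : CGroupAlgebra Lamplighter :=
  single shift 1 * (single 1 (1 / 2) - single lamp (1 / 2)) +
    (single 1 (1 / 2) + single lamp (1 / 2))

/-- The operator by which `halfShift` acts in `lamplighterRep`. -/
def halfShiftOp : EllTwo →L[ℂ] EllTwo := lamplighterRep.toAlgHom halfShift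

/-- `halfShiftOp` is the unilateral shift on `ℓ²(ℤ≥0)` and the identity on `ℓ²(ℤ<0)`. -/
theorem halfShiftOp_apply (ξ : EllTwo) (n : ℤ) :
    halfShiftOp ξ n = if 0 < n then ξ (n - 1) else if n = 0 then 0 else ξ n := by
  have h : halfShiftOp = lamplighterAction Lamplighter.shift *
      ((1 / 2 : ℂ) • 1 - (1 / 2 : ℂ) • lamplighterAction Lamplighter.lamp) +
      ((1 / 2 : ℂ) • 1 + (1 / 2 : ℂ) • lamplighterAction Lamplighter.lamp) := by
    rw [halfShiftOp, halfShift]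
    simp only [map_add, map_mul, map_sub, UnitaryRep.toAlgHom_single, map_one, one_smul]
    rfl
  have hu (η : EllTwo) (m : ℤ) : lamplighterAction Lamplighter.shift η m = η (m - 1) := by
    change ((lampSign 1 m : ℤ) : ℂ) * η (m - 1) = _
    simp [lampSign_one]
  have ha (η : EllTwo) (m : ℤ) :
      lamplighterAction Lamplighter.lamp η m = if 0 ≤ m then - η m else η m := by
    change ((lampSign (Pi.mulSingle 1 (.ofAdd 1)) m : ℤ) : ℂ) * η (m - 0) = _
    rw [lampSign_mulSingle]
    split_ifs <;> simp
  have h1 : halfShiftOp ξ n =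
      (1 / 2 * ξ (n - 1) - 1 / 2 * lamplighterAction Lamplighter.lamp ξ (n - 1)) +
        (1 / 2 * ξ n + 1 / 2 * lamplighterAction Lamplighter.lamp ξ n) := by
    rw [h]
    exact congrArg (· + _) (hu _ n)
  rw [h1, ha, ha]
  obtain hn | rfl | hn := lt_trichotomy n 0
  · have hn' : ¬ 0 ≤ n - 1 := by lia
    simp only [hn', hn.not_ge, hn.not_gt, hn.ne, if_false]
    ring
  · simp
  · have hn' : 0 ≤ n - 1 := by lia
    simp only [hn', hn.le, hn, if_true]
    ring

theorem norm_halfShiftOp_apply (ξ : EllTwo) : ‖halfShiftOp ξ‖ = ‖ξ‖ := by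
  -- `halfShiftOp` moves the coordinate at `n` to `j n`, and `0` is not a value of `j`.
  let j : ℤ → ℤ := fun n => if 0 ≤ n then n + 1 else n
  have hj : Function.Injective j := fun m n h => by
    simp only [j] at h
    split_ifs at h <;> lia
  have hξ (n : ℤ) : halfShiftOp ξ (j n) = ξ n := by
    rw [halfShiftOp_apply]
    by_cases hn : 0 ≤ n
    · simp [j, hn, Int.lt_add_one_of_le hn]
    · rw [show j n = n from if_neg hn, if_neg (by lia), if_neg (by lia)]
  rw [lp.norm_eq_tsum_rpow (by norm_num), lp.norm_eq_tsum_rpow (by norm_num), ← hj.tsum_eq]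
  · simp_rw [hξ]
  · intro n hn
    have hn0 : n ≠ 0 := by
      rintro rfl
      exact hn (by simp [halfShiftOp_apply])
    obtain h | h := hn0.lt_or_gt
    · exact ⟨n, if_neg (by lia)⟩
    · exact ⟨n - 1, by simp only [j]; rw [if_pos (by lia)]; lia⟩

end

theorem mainTheorem8 : ¬ IsStronglyQuasidiagonal (FullGroupCStarAlgebra Lamplighter) := by
  intro h
  have : TopologicalSpace.SeparableSpace lamplighterRep.H := EllTwo.instSeparableSpace
  have hperp (ξ : EllTwo) : inner ℂ (halfShiftOp ξ) (lp.single 2 0 1 : EllTwo) = 0 := by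
    rw [lp.inner_single_right, halfShiftOp_apply]
    simp
  have h0 : (lp.single 2 0 1 : EllTwo) = 0 :=
    UnitaryRep.eq_zero_of_isStronglyQuasidiagonal h lamplighterRep halfShift
      norm_halfShiftOp_apply hperp
  have h1 : ‖(lp.single 2 0 1 : EllTwo)‖ = 1 := by
    rw [lp.norm_single (by norm_num), norm_one]
  rw [h0, norm_zero] at h1
  exact zero_ne_one h1
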